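/- Let $X$ be a complex Banach space and let $A:D(A)\subset X\to X$ be the infinitesimal generator of a $C_0$-semigroup $T(t)$, $t\ge 0$, on $X$. For a norm-continuous bounded $B:\mathbb R\to L(X)$, a (mild) solution of $\dot y=Ay+B(t)y$ on $[s,\infty)$ is a continuous $y:[s,\infty)\to X$ with $y(t)=T(t-s)y(s)+\int_s^tT(t-u)B(u)y(u)\,du$ for $t\ge s$. The system is called asymptotically stable if its zero solution is stable and attractive, uniformly in the initial time: for every $\varepsilon>0$ there is $\eta>0$ such that $\|y(s)\|<\eta$ implies $\|y(t)\|<\varepsilon$ for all $s\in\mathbb R$, all solutions $y$ on $[s,\infty)$ and all $t\ge s$; and there is $\eta>0$ such that for every $\varepsilon>0$ there is $\tau>0$ with $\|y(t)\|<\varepsilon$ whenever $\|y(s)\|<\eta$ and $t\ge s+\tau$, for all $s$ and all solutions $y$ on $[s,\infty)$. A separated decomposition of the spectrum of $A$ consists of a bounded closed set $\sigma_1\subset\sigma(A)$ such that $\sigma_2=\sigma(A)\setminus\sigma_1$ is closed in $\mathbb C$, and a positively oriented simple closed $C^1$ curve $\Gamma$ with $\sigma_1$ in its interior and $\sigma_2$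 in its exterior. Put $$P_1=\frac1{2\pi i}\oint_\Gamma(\lambda-A)^{-1}\,d\lambda ,\qquad P_2=I-P_1 .$$ (i) For every separated decomposition, $P_1X\subset D(A)$, $AP_1$ is a bounded operator, and $P_1Ax=AP_1x$ for $x\in D(A)$; so $P_1A$ extends to the bounded operator $AP_1$ on $X$. (ii) Suppose that $\dot x=Ax$ is asymptotically stable, and let $K,\alpha,\mu,M\in\mathbb R$ with $\mu>\alpha$. Then there are $\delta_0>0$ and $h_0>0$, depending only on $T,K,\alpha,\mu,M$, such that the following holds for all $0<\delta\le\delta_0$ and $h\ge h_0$. Consider a separated decomposition with $$\|T(t)P_1\|\le Ke^{-\alpha t},\qquad \|T(t)P_2\|\le Ke^{-\mu t}\qquad(t\ge0),$$ and a norm-continuous $B:\mathbb R\to L(X)$ with $\|B(t)\|\le M$ and $\|P_2B(t)\|\le M\delta$ for all $t\in\mathbb R$. Let $C_t(u)=\int_t^uB(\tau)\,d\tau$ and suppose that for all $t\in\mathbb R$ and $t\le u\le t+h$ $$\|P_1C_t(u)B(u)\|\le M\delta,\qquad \|P_1AC_t(u)\|\le M\delta,\qquad \|P_1C_t(u)A\|\le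 M\delta ,$$ where $P_1A$ in the second condition denotes the bounded operator $AP_1$, and the third condition means $\|P_1C_t(u)Ax\|\le M\delta\|x\|$ for $x\in D(A)$. Then for all $s\in\mathbb R$, $x\in X$ the system $\dot y=Ay+B(t)y$ has a solution on $[s,\infty)$ with $y(s)=x$, and this system is asymptotically stable. -/

import Mathlib

open Set Filter Topology

namespace Semigroups

noncomputable section

section Curves

/-- The point set of a curve parametrised by `[0, 1]`. -/
def trace (γ : ℝ → ℂ) : Set ℂ := γ '' Icc 0 1

/-- The interior of a closed curve: points off the curve whose component in the complement of the
curve is bounded. -/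
def curveInterior (γ : ℝ → ℂ) : Set ℂ :=
  {z | z ∉ trace γ ∧ Bornology.IsBounded (connectedComponentIn (trace γ)ᶜ z)}

/-- The exterior of a closed curve: points off the curve whose component in the complement of the
curve is unbounded. -/
def curveExterior (γ : ℝ → ℂ) : Set ℂ :=
  {z | z ∉ trace γ ∧ ¬ Bornology.IsBounded (connectedComponentIn (trace γ)ᶜ z)}

/-- The winding number `(2πi)⁻¹ ∮ (w - z)⁻¹ dw`. -/
def windingNumber (γ : ℝ → ℂ) (z : ℂ) : ℂ :=
  (2 * Real.pi * Complex.I)⁻¹ * ∫ t in (0 : ℝ)..1, deriv γ t * (γ t - z)⁻¹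

/-- A positively oriented simple closed `C¹` curve. -/
structure IsPositiveJordanCurve (γ : ℝ → ℂ) : Prop where
  contDiffOn : ContDiffOn ℝ 1 γ (Icc 0 1)
  closed : γ 0 = γ 1
  simple : InjOn γ (Ico 0 1)
  positive : ∀ z ∈ curveInterior γ, windingNumber γ z = 1

end Curves

variable {X : Type*} [NormedAddCommGroup X] [NormedSpace ℂ X]

section Operators

/-- `R` is the bounded two-sided inverse of `z - A : D(A) → X`. -/
def IsResolventAt (A : X →ₗ.[ℂ] X) (z : ℂ) (R : X →L[ℂ] X) : Prop :=
  (∀ x : X, ∃ hx : R x ∈ A.domain, z • R x - A ⟨R x, hx⟩ = x) ∧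
    ∀ x : A.domain, R (z • (x : X) - A x) = x

/-- The spectrum of the (possibly unbounded) operator `A`. -/
def spec (A : X →ₗ.[ℂ] X) : Set ℂ := {z | ¬ ∃ R : X →L[ℂ] X, IsResolventAt A z R}

open Classical in
/-- The resolvent `(z - A)⁻¹`; by convention `0` for `z` in the spectrum. -/
def resolv (A : X →ₗ.[ℂ] X) (z : ℂ) : X →L[ℂ] X :=
  if h : ∃ R : X →L[ℂ] X, IsResolventAt A z R then h.choose else 0

/-- The Riesz projection `(2πi)⁻¹ ∮ (z - A)⁻¹ dz` along the curve `γ`. -/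
def rieszProj (A : X →ₗ.[ℂ] X) (γ : ℝ → ℂ) : X →L[ℂ] X :=
  (2 * Real.pi * Complex.I : ℂ)⁻¹ • ∫ t in (0 : ℝ)..1, deriv γ t • resolv A (γ t)

/-- `σ₁` is a bounded spectral set of `A`, separated by the positively oriented curve `γ` from the
remainder `σ₂ = σ(A) \ σ₁`. -/
structure IsSeparated (A : X →ₗ.[ℂ] X) (σ₁ : Set ℂ) (γ : ℝ → ℂ) : Prop where
  subset : σ₁ ⊆ spec A
  bounded : Bornology.IsBounded σ₁
  isClosed_fst : IsClosed σ₁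
  isClosed_snd : IsClosed (spec A \ σ₁)
  curve : IsPositiveJordanCurve γ
  fst_interior : σ₁ ⊆ curveInterior γ
  snd_exterior : spec A \ σ₁ ⊆ curveExterior γ

/-- `A L` is everywhere defined and `‖A L‖ ≤ c`. -/
def NormCompLeftLE (A : X →ₗ.[ℂ] X) (L : X →L[ℂ] X) (c : ℝ) : Prop :=
  ∀ x : X, ∃ hx : L x ∈ A.domain, ‖A ⟨L x, hx⟩‖ ≤ c * ‖x‖

/-- `L A`, defined on `D(A)`, satisfies `‖L A‖ ≤ c`. -/
def NormCompRightLE (A : X →ₗ.[ℂ] X) (L : X →L[ℂ] X) (c : ℝ) : Prop :=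
  ∀ x : A.domain, ‖L (A x)‖ ≤ c * ‖(x : X)‖

end Operators

section Evolution

/-- `T(t)`, `t ≥ 0`, is a `C₀`-semigroup; the values at `t < 0` are irrelevant. -/
structure IsC0Semigroup (T : ℝ → X →L[ℂ] X) : Prop where
  zero : T 0 = ContinuousLinearMap.id ℂ X
  add : ∀ s t : ℝ, 0 ≤ s → 0 ≤ t → T (s + t) = (T s).comp (T t)
  continuousOn : ∀ x : X, ContinuousOn (fun t => T t x) (Ici 0)

/-- `A` is the infinitesimal generator of `T`, with its maximal domain. -/
structure IsGenerator (T : ℝ → X →L[ℂ] X) (A : X →ₗ.[ℂ] X) : Prop where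
  mem_domain : ∀ x : X, x ∈ A.domain ↔
    ∃ y : X, Tendsto (fun t : ℝ => t⁻¹ • (T t x - x)) (𝓝[>] 0) (𝓝 y)
  tendsto : ∀ x : A.domain,
    Tendsto (fun t : ℝ => t⁻¹ • (T t (x : X) - x)) (𝓝[>] 0) (𝓝 (A x))

/-- `y` is a (mild) solution on `[s, ∞)` of `y' = A y + B(t) y`, where `A` generates `T`: the
variation of constants formula holds. -/
structure IsSolution (T B : ℝ → X →L[ℂ] X) (s : ℝ) (y : ℝ → X) : Prop where
  continuousOn : ContinuousOn y (Ici s)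
  formula : ∀ t, s ≤ t → y t = T (t - s) (y s) + ∫ u in s..t, T (t - u) (B u (y u))

/-- The linear system `y' = A y + B(t) y`, where `A` generates `T`, is asymptotically stable:
the zero solution is stable and attractive, uniformly in the initial time. -/
structure IsAsympStable (T B : ℝ → X →L[ℂ] X) : Prop where
  stable : ∀ ε > 0, ∃ η > 0, ∀ (s : ℝ) (y : ℝ → X), IsSolution T B s y → ‖y s‖ < η →
    ∀ t, s ≤ t → ‖y t‖ < ε
  attractive : ∃ η > 0, ∀ ε > 0, ∃ τ > 0, ∀ (s : ℝ) (y : ℝ → X), IsSolution T B s y → ‖y s‖ < η →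
    ∀ t, s + τ ≤ t → ‖y t‖ < ε

/-- `C_t(u) = ∫_t^u B(τ) dτ`. -/
def primitive (B : ℝ → X →L[ℂ] X) (t u : ℝ) : X →L[ℂ] X := ∫ τ in t..u, B τ

end Evolution

end

end Semigroups

/-! On the contour `A R(λ) = λ R(λ) - I` is bounded and continuous in `λ`, so integrating it gives a
bounded operator that must be both `A P₁` and the extension of `P₁ A`
(`IsSeparated.exists_comp_rieszProj`).

For robustness, stability of `x' = A x` yields `‖T(t)‖ ≤ C` and a time `h₀` with `‖T(h₀)‖ ≤ 1/4`. It
is enough that the perturbation changes a solution over one step of length `h₀` by at most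
`‖y(s)‖/4`: the norm then halves at each step. By variation of constants the change is `∫ T(t-u) (P₁
+ P₂) B(u) y(u) du`. The `P₂` part is small by assumption. The `P₁` part is small only on average:
`G(u) = P₁ C_s(u)` is a primitive of `P₁ B(u)`, and formally `d/du [T(t-u) G y] = T(t-u) (P₁ B - A G
+ G A + G B) y`, where the last three terms are `O(δ)` (`norm_sub_integral_le`). The boundary term
`G(t) y(t)` is small as well, because a small `G A` forces a small `G` when `T(h₀)` is a strict
contraction (`norm_le_of_normCompRightLE`). The one-step bound is `norm_solution_le`; existence
(`exists_isSolution`) is a weighted fixed point argument. -/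

namespace Semigroups

/-! ### Resolvents and the boundedness of `A P₁`. -/

section Resolvent

variable {X : Type*} [NormedAddCommGroup X] [NormedSpace ℂ X]

theorem isResolventAt_resolv {A : X →ₗ.[ℂ] X} {z : ℂ} (hz : z ∉ spec A) :
    IsResolventAt A z (resolv A z) := by
  have h : ∃ R : X →L[ℂ] X, IsResolventAt A z R := by
    simpa [spec] using hz
  rw [resolv, dif_pos h]
  exact h.choose_spec

/-- The resolvent identity `R(z) = R(w) ((w - z) R(z) + 1)`, in pointwise form. -/
theorem IsResolventAt.apply_eq {A : X →ₗ.[ℂ] X} {z w : ℂ} {R S : X →L[ℂ] X}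
    (hR : IsResolventAt A z R) (hS : IsResolventAt A w S) (x : X) :
    R x = S (w • R x - (z • R x - x)) := by
  obtain ⟨hx, h⟩ := hR.1 x
  have h' := hS.2 ⟨R x, hx⟩
  have hA : A ⟨R x, hx⟩ = z • R x - x := by
    rw [eq_sub_iff_add_eq, add_comm]
    exact (sub_eq_iff_eq_add.mp h).symm
  rw [hA] at h'
  exact h'.symm

theorem continuousOn_resolv (A : X →ₗ.[ℂ] X) : ContinuousOn (resolv A) (spec A)ᶜ := by
  intro w hw
  have key : ∀ z ∈ (spec A)ᶜ, ‖resolv A z - resolv A w‖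
      ≤ ‖z - w‖ * (‖resolv A w‖ * ‖resolv A z‖) := by
    intro z hz
    refine ContinuousLinearMap.opNorm_le_bound _ (by positivity) fun x => ?_
    have h := (isResolventAt_resolv hz).apply_eq (isResolventAt_resolv hw) x
    have h2 : (resolv A z - resolv A w) x = -((z - w) • resolv A w (resolv A z x)) := by
      rw [_root_.sub_apply]
      nth_rewrite 1 [h]
      simp only [map_sub, map_smul, sub_smul]
      abel
    rw [h2, norm_neg, norm_smul, mul_assoc, mul_assoc]
    gcongr
    exact (ContinuousLinearMap.le_opNorm _ _).trans
      (by gcongr; exact ContinuousLinearMap.le_opNorm _ _)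
  set r := ‖resolv A w‖
  have hlim : Tendsto (fun z => ‖z - w‖) (𝓝[(spec A)ᶜ] w) (𝓝 0) := by
    have : Continuous fun z : ℂ => ‖z - w‖ := by fun_prop
    simpa using (this.tendsto w).mono_left nhdsWithin_le_nhds
  have hsmall : ∀ᶠ z in 𝓝[(spec A)ᶜ] w, ‖z - w‖ * r < 1 / 2 := by
    have : Tendsto (fun z => ‖z - w‖ * r) (𝓝[(spec A)ᶜ] w) (𝓝 0) := by
      simpa using hlim.mul_const r
    exact this.eventually_lt_const (by norm_num)
  rw [ContinuousWithinAt, tendsto_iff_norm_sub_tendsto_zero]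
  refine squeeze_zero' (.of_forall fun _ => norm_nonneg _) ?_
    (show Tendsto (fun z => ‖z - w‖ * (r * (2 * r))) _ (𝓝 0) by
      simpa using hlim.mul_const (r * (2 * r)))
  filter_upwards [hsmall, self_mem_nhdsWithin] with z hz hzs
  refine (key z hzs).trans ?_
  -- The bound `key` still contains `‖resolv A z‖`; for `‖z - w‖ r < 1/2` it can be absorbed.
  have h1 : ‖resolv A z‖ ≤ r + ‖resolv A z - resolv A w‖ := by
    have := norm_add_le (resolv A w) (resolv A z - resolv A w)
    rwa [add_sub_cancel] at this
  have h2 : ‖resolv A z‖ ≤ 2 * r := by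
    have := key z hzs
    nlinarith [norm_nonneg (resolv A z)]
  gcongr

/-- At the endpoints `deriv γ` may be the default value `0`; it agrees with the continuous one-sided
derivative on the open interval, which suffices for integration. -/
theorem intervalIntegrable_deriv_of_contDiffOn {γ : ℝ → ℂ}
    (h : ContDiffOn ℝ 1 γ (Icc 0 1)) :
    IntervalIntegrable (deriv γ) MeasureTheory.volume 0 1 := by
  have hc : ContinuousOn (derivWithin γ (Icc 0 1)) (Icc 0 1) :=
    h.continuousOn_derivWithin (uniqueDiffOn_Icc zero_lt_one) le_rfl
  refine (ContinuousOn.intervalIntegrable_of_Icc zero_le_one hc).congr_uIoo ?_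
  rw [uIoo_of_le zero_le_one]
  exact fun t ht => derivWithin_of_mem_nhds (Icc_mem_nhds ht.1 ht.2)

theorem IsSeparated.trace_disjoint {A : X →ₗ.[ℂ] X} {σ₁ : Set ℂ} {γ : ℝ → ℂ}
    (h : IsSeparated A σ₁ γ) {t : ℝ} (ht : t ∈ Icc (0 : ℝ) 1) : γ t ∈ (spec A)ᶜ := by
  intro hs
  have hm : γ t ∈ trace γ := mem_image_of_mem γ ht
  by_cases h1 : γ t ∈ σ₁
  · exact (h.fst_interior h1).1 hm
  · exact (h.snd_exterior ⟨hs, h1⟩).1 hm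

variable [CompleteSpace X]

/-- `A P₁` is bounded and agrees with `P₁ A` on `D(A)`. -/
theorem IsSeparated.exists_comp_rieszProj {A : X →ₗ.[ℂ] X} {σ₁ : Set ℂ} {γ : ℝ → ℂ}
    (h : IsSeparated A σ₁ γ) :
    ∃ L : X →L[ℂ] X,
      (∀ x : X, ∃ hx : rieszProj A γ x ∈ A.domain, A ⟨rieszProj A γ x, hx⟩ = L x) ∧
      ∀ x : A.domain, rieszProj A γ (A x) = L x := by
  have hγ := intervalIntegrable_deriv_of_contDiffOn h.curve.contDiffOn
  have hγc : ContinuousOn γ (uIcc 0 1) := by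
    rw [uIcc_of_le zero_le_one]; exact h.curve.contDiffOn.continuousOn
  have hR : ContinuousOn (fun t => resolv A (γ t)) (uIcc 0 1) := by
    refine (continuousOn_resolv A).comp hγc fun t ht => h.trace_disjoint ?_
    rwa [uIcc_of_le zero_le_one] at ht
  have hi1 : IntervalIntegrable (fun t => deriv γ t • resolv A (γ t))
      MeasureTheory.volume 0 1 := hγ.smul_continuousOn hR
  have hi2 : IntervalIntegrable
      (fun t => deriv γ t • (γ t • resolv A (γ t) - ContinuousLinearMap.id ℂ X))
      MeasureTheory.volume 0 1 :=
    hγ.smul_continuousOn ((hγc.smul hR).sub continuousOn_const)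
  set c : ℂ := (2 * Real.pi * Complex.I)⁻¹
  let L : X →L[ℂ] X :=
    c • ∫ t in (0 : ℝ)..1, deriv γ t • (γ t • resolv A (γ t) - ContinuousLinearMap.id ℂ X)
  have hP : ∀ x, rieszProj A γ x = c • ∫ t in (0 : ℝ)..1, deriv γ t • resolv A (γ t) x := by
    intro x
    rw [rieszProj, _root_.smul_apply, ContinuousLinearMap.intervalIntegral_apply hi1]
    rfl
  have hL : ∀ x, L x =
      c • ∫ t in (0 : ℝ)..1, deriv γ t • (γ t • resolv A (γ t) x - x) := by
    intro x
    simp only [L]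
    rw [_root_.smul_apply, ContinuousLinearMap.intervalIntegral_apply hi2]
    rfl
  have hz : γ 0 ∈ (spec A)ᶜ := h.trace_disjoint (by simp)
  have hres := isResolventAt_resolv hz
  refine ⟨L, fun x => ?_, fun x => ?_⟩
  -- Instead of moving the unbounded `A` through the integral, the resolvent identity extracts the
  -- fixed bounded operator `R(γ 0)`. Its range lies in `D(A)`, and the value of `A` is then read
  -- off.
  · have hPx : rieszProj A γ x = resolv A (γ 0) (γ 0 • rieszProj A γ x - L x) := by
      have hj1 : IntervalIntegrable (fun t => deriv γ t • resolv A (γ t) x)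
          MeasureTheory.volume 0 1 :=
        hγ.smul_continuousOn (hR.clm_apply continuousOn_const)
      have hj2 : IntervalIntegrable (fun t => deriv γ t • (γ t • resolv A (γ t) x - x))
          MeasureTheory.volume 0 1 :=
        hγ.smul_continuousOn
          ((hγc.smul (hR.clm_apply continuousOn_const)).sub continuousOn_const)
      have hj3 : IntervalIntegrable (fun t => γ 0 • (deriv γ t • resolv A (γ t) x))
          MeasureTheory.volume 0 1 := hj1.smul (γ 0)
      have e : γ 0 • rieszProj A γ x - L x =
          c • ∫ t in (0 : ℝ)..1, (γ 0 • (deriv γ t • resolv A (γ t) x) -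
            deriv γ t • (γ t • resolv A (γ t) x - x)) := by
        rw [intervalIntegral.integral_sub hj3 hj2, intervalIntegral.integral_smul,
          hP, hL, smul_sub, smul_comm]
      rw [e, map_smul, ← ContinuousLinearMap.intervalIntegral_comp_comm _
        (hj3.sub hj2), hP]
      congr 1
      refine intervalIntegral.integral_congr fun t ht => ?_
      rw [uIcc_of_le zero_le_one] at ht
      have := (isResolventAt_resolv (h.trace_disjoint ht)).apply_eq hres x
      nth_rewrite 1 [this]
      rw [smul_comm, ← smul_sub, map_smul]
    obtain ⟨hd, he⟩ := hres.1 (γ 0 • rieszProj A γ x - L x)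
    refine ⟨hPx ▸ hd, ?_⟩
    simp only [← hPx] at he
    exact (sub_right_inj.mp he)
  · rw [hP, hL]
    congr 1
    refine intervalIntegral.integral_congr fun t ht => ?_
    rw [uIcc_of_le zero_le_one] at ht
    have := (isResolventAt_resolv (h.trace_disjoint ht)).2 x
    rw [map_sub, map_smul] at this
    congr 1
    exact eq_sub_of_add_eq (by rw [add_comm]; exact (sub_eq_iff_eq_add.mp this).symm)

end Resolvent

/-! ### Semigroups, generators and mild solutions. -/

section Semigroup

variable {X : Type*} [NormedAddCommGroup X] [NormedSpace ℂ X]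

/-- The values of a semigroup at negative times may be replaced so that every orbit is continuous
on the whole line. -/
theorem IsC0Semigroup.comp_max {T : ℝ → X →L[ℂ] X} (hT : IsC0Semigroup T) :
    IsC0Semigroup fun r => T (max r 0) where
  zero := by simpa using hT.zero
  add s t hs ht := by
    rw [max_eq_left (add_nonneg hs ht), max_eq_left hs, max_eq_left ht]
    exact hT.add s t hs ht
  continuousOn x := (hT.continuousOn x).congr fun t ht => by
    simp only
    rw [max_eq_left ht]

/-- Strong continuity becomes joint continuity because the operators are uniformly bounded. -/
theorem IsC0Semigroup.continuous_comp_max {T : ℝ → X →L[ℂ] X} (hT : IsC0Semigroup T) {C : ℝ}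
    (hC : ∀ r, 0 ≤ r → ‖T r‖ ≤ C) : Continuous fun p : ℝ × X => T (max p.1 0) p.2 := by
  have hC0 : 0 ≤ C := (norm_nonneg _).trans (hC 0 le_rfl)
  rw [continuous_iff_continuousAt]
  rintro ⟨r₀, x₀⟩
  have h1 : Continuous fun r : ℝ => T (max r 0) x₀ :=
    (hT.continuousOn x₀).comp_continuous (by fun_prop) fun r => le_max_right r 0
  rw [ContinuousAt, tendsto_iff_norm_sub_tendsto_zero]
  have hlim : Tendsto (fun p : ℝ × X => C * ‖p.2 - x₀‖ + ‖T (max p.1 0) x₀ - T (max r₀ 0) x₀‖)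
      (𝓝 (r₀, x₀)) (𝓝 0) := by
    have : Continuous fun p : ℝ × X =>
        C * ‖p.2 - x₀‖ + ‖T (max p.1 0) x₀ - T (max r₀ 0) x₀‖ := by
      have := h1.comp (continuous_fst (X := ℝ) (Y := X))
      exact (by fun_prop : Continuous fun p : ℝ × X => C * ‖p.2 - x₀‖).add
        (this.sub continuous_const).norm
    simpa using this.tendsto (r₀, x₀)
  refine squeeze_zero (fun _ => norm_nonneg _) (fun p => ?_) hlim
  have e : T (max p.1 0) p.2 - T (max r₀ 0) x₀ =
      T (max p.1 0) (p.2 - x₀) + (T (max p.1 0) x₀ - T (max r₀ 0) x₀) := by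
    rw [map_sub]; abel
  rw [e]
  refine (norm_add_le _ _).trans ?_
  gcongr
  exact ContinuousLinearMap.le_of_opNorm_le _ (hC _ (le_max_right _ _)) _

theorem IsGenerator.comp_max {T : ℝ → X →L[ℂ] X} {A : X →ₗ.[ℂ] X} (hA : IsGenerator T A) :
    IsGenerator (fun r => T (max r 0)) A := by
  have h : ∀ x : X, (fun t : ℝ => t⁻¹ • (T (max t 0) x - x)) =ᶠ[𝓝[>] 0]
      fun t : ℝ => t⁻¹ • (T t x - x) := fun x => by
    filter_upwards [self_mem_nhdsWithin] with t ht
    rw [max_eq_left (le_of_lt ht)]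
  exact ⟨fun x => by simpa only [tendsto_congr' (h x)] using hA.mem_domain x,
    fun x => by simpa only [tendsto_congr' (h (x : X))] using hA.tendsto x⟩

theorem isSolution_comp_max_iff {T B : ℝ → X →L[ℂ] X} {s : ℝ} {y : ℝ → X} :
    IsSolution (fun r => T (max r 0)) B s y ↔ IsSolution T B s y := by
  have h : ∀ t, s ≤ t → T (max (t - s) 0) (y s) + (∫ u in s..t, T (max (t - u) 0) (B u (y u))) =
      T (t - s) (y s) + ∫ u in s..t, T (t - u) (B u (y u)) := by
    intro t ht
    rw [max_eq_left (sub_nonneg.2 ht)]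
    congr 1
    refine intervalIntegral.integral_congr fun u hu => ?_
    rw [uIcc_of_le ht] at hu
    rw [max_eq_left (sub_nonneg.2 hu.2)]
  exact ⟨fun H => ⟨H.1, fun t ht => (H.2 t ht).trans (h t ht)⟩,
    fun H => ⟨H.1, fun t ht => (H.2 t ht).trans (h t ht).symm⟩⟩

/-- Freezing `y` at `y s` before time `s` makes it continuous on the whole line without affecting
the formula. -/
theorem IsSolution.comp_max {T B : ℝ → X →L[ℂ] X} {s : ℝ} {y : ℝ → X} (hy : IsSolution T B s y) :
    IsSolution T B s fun t => y (max t s) := by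
  refine ⟨hy.1.congr fun t ht => by rw [max_eq_left ht], fun t ht => ?_⟩
  simp only [max_eq_left ht, max_self]
  rw [hy.2 t ht]
  congr 1
  refine intervalIntegral.integral_congr fun u hu => ?_
  rw [uIcc_of_le ht] at hu
  rw [max_eq_left hu.1]

theorem IsSolution.continuous_comp_max {T B : ℝ → X →L[ℂ] X} {s : ℝ} {y : ℝ → X}
    (hy : IsSolution T B s y) : Continuous fun t => y (max t s) :=
  hy.1.comp_continuous (by fun_prop) fun t => le_max_right t s

variable [CompleteSpace X]

/-- Shrinking averages of a jointly continuous family converge. -/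
theorem tendsto_average {g : ℝ → ℝ → X} (hg : Continuous fun p : ℝ × ℝ => g p.1 p.2) (u : ℝ) :
    Tendsto (fun k : ℝ => k⁻¹ • ∫ r in u..u + k, g k r) (𝓝[>] 0) (𝓝 (g 0 u)) := by
  rw [Metric.tendsto_nhds]
  intro ε hε
  have h1 := Metric.tendsto_nhds.1 (hg.tendsto (0, u)) (ε / 2) (half_pos hε)
  obtain ⟨d, hd, hball⟩ := Metric.eventually_nhds_iff.1 h1
  filter_upwards [Ioo_mem_nhdsGT hd] with k hk
  have hk0 : k ≠ 0 := hk.1.ne'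
  have hint : IntervalIntegrable (fun r => g k r) MeasureTheory.volume u (u + k) :=
    Continuous.intervalIntegrable (by exact hg.comp (by fun_prop : Continuous fun r => (k, r))) _ _
  have e : k⁻¹ • (∫ r in u..u + k, g k r) - g 0 u = k⁻¹ • ∫ r in u..u + k, (g k r - g 0 u) := by
    rw [intervalIntegral.integral_sub hint (by simp), intervalIntegral.integral_const,
      add_sub_cancel_left, smul_sub, inv_smul_smul₀ hk0]
  rw [dist_eq_norm, e, norm_smul]
  have hb : ‖∫ r in u..u + k, (g k r - g 0 u)‖ ≤ ε / 2 * |u + k - u| := by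
    refine intervalIntegral.norm_integral_le_of_norm_le_const fun r hr => ?_
    rw [uIoc_of_le (by linarith [hk.1])] at hr
    rw [← dist_eq_norm]
    refine (hball (y := (k, r)) ?_).le
    rw [Prod.dist_eq, max_lt_iff, Real.dist_eq, Real.dist_eq, abs_of_nonneg (by linarith [hk.1]),
      abs_of_nonneg (by simp; linarith [hr.1])]
    constructor <;> simp <;> linarith [hk.2, hr.2]
  rw [add_sub_cancel_left, abs_of_pos hk.1] at hb
  rw [norm_inv, Real.norm_of_nonneg hk.1.le]
  calc k⁻¹ * _ ≤ k⁻¹ * (ε / 2 * k) := by gcongr; exact inv_nonneg.2 hk.1.le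
    _ = ε / 2 := by field_simp
    _ < ε := half_lt_self hε

/-- Since `T(k)` shifts the integral to `[k, k + h]`, the difference quotient is the slope of `t ↦
∫₀ᵗ T(r) x dr` at `h` minus that at `0`. -/
theorem IsGenerator.integral_mem {T : ℝ → X →L[ℂ] X} {A : X →ₗ.[ℂ] X} (hT : IsC0Semigroup T)
    (hA : IsGenerator T A) (hc : Continuous fun p : ℝ × X => T p.1 p.2) (x : X) {h : ℝ}
    (hh : 0 ≤ h) :
    ∃ hx : (∫ r in (0 : ℝ)..h, T r x) ∈ A.domain, A ⟨∫ r in (0 : ℝ)..h, T r x, hx⟩ = T h x - x := by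
  have hcx : Continuous fun r => T r x := hc.comp (by fun_prop : Continuous fun r : ℝ => (r, x))
  have hi : ∀ a b, IntervalIntegrable (fun r => T r x) MeasureTheory.volume a b :=
    fun a b => hcx.intervalIntegrable a b
  have hd : ∀ t, HasDerivAt (fun t => ∫ r in (0 : ℝ)..t, T r x) (T t x) t := fun t =>
    intervalIntegral.integral_hasDerivAt_right (hi _ _)
      hcx.stronglyMeasurable.stronglyMeasurableAtFilter hcx.continuousAt
  have hlim : Tendsto (fun t : ℝ => t⁻¹ • (T t (∫ r in (0 : ℝ)..h, T r x) -
      ∫ r in (0 : ℝ)..h, T r x)) (𝓝[>] 0) (𝓝 (T h x - x)) := by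
    have h1 := (hd h).tendsto_slope_zero_right.sub (hd 0).tendsto_slope_zero_right
    have h0 : T 0 x = x := by rw [hT.zero]; rfl
    rw [h0] at h1
    refine h1.congr' ?_
    filter_upwards [self_mem_nhdsWithin] with k hk
    rw [← smul_sub]
    congr 1
    have e : T k (∫ r in (0 : ℝ)..h, T r x) = ∫ r in k..k + h, T r x := by
      rw [← ContinuousLinearMap.intervalIntegral_comp_comm _ (hi 0 h)]
      have := intervalIntegral.integral_comp_add_left (a := 0) (b := h) (fun r => T r x) k
      rw [add_zero] at this
      rw [← this]
      refine intervalIntegral.integral_congr fun r hr => ?_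
      rw [uIcc_of_le hh] at hr
      rw [hT.add k r (le_of_lt hk) hr.1]
      rfl
    rw [e, zero_add, intervalIntegral.integral_same, sub_zero, add_comm h k,
      ← intervalIntegral.integral_add_adjacent_intervals (hi 0 k) (hi k (k + h))]
    abel
  have hx : (∫ r in (0 : ℝ)..h, T r x) ∈ A.domain := (hA.mem_domain _).2 ⟨_, hlim⟩
  exact ⟨hx, tendsto_nhds_unique (hA.tendsto ⟨_, hx⟩) hlim⟩

/-- The restart property of mild solutions. -/
theorem IsSolution.restart {T B : ℝ → X →L[ℂ] X} (hT : IsC0Semigroup T)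
    (hc : Continuous fun p : ℝ × X => T p.1 p.2) (hB : Continuous B) {s : ℝ} {y : ℝ → X}
    (hyc : Continuous y) (hy : IsSolution T B s y) {s' : ℝ} (hs : s ≤ s') :
    IsSolution T B s' y := by
  refine ⟨hyc.continuousOn, fun t ht => ?_⟩
  have hi : ∀ c a b, IntervalIntegrable (fun r => T (c - r) (B r (y r)))
      MeasureTheory.volume a b := fun c a b =>
    (hc.comp (by fun_prop : Continuous fun r : ℝ => (c - r, B r (y r)))).intervalIntegrable a b
  rw [hy.2 t (hs.trans ht), hy.2 s' hs, map_add,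
    ← ContinuousLinearMap.intervalIntegral_comp_comm _ (hi s' s s'),
    ← intervalIntegral.integral_add_adjacent_intervals (hi t s s') (hi t s' t), ← add_assoc]
  congr 1
  congr 1
  · have := hT.add (t - s') (s' - s) (by linarith) (by linarith)
    rw [sub_add_sub_cancel] at this
    rw [this]; rfl
  · refine intervalIntegral.integral_congr fun r hr => ?_
    rw [uIcc_of_le hs] at hr
    have := hT.add (t - s') (s' - r) (by linarith) (by linarith [hr.2])
    rw [sub_add_sub_cancel] at this
    rw [this]; rfl

end Semigroup

/-! ### Integration by parts and contraction over one time step. -/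

section Averaging

variable {X : Type*} [NormedAddCommGroup X] [NormedSpace ℂ X] [CompleteSpace X]

/-- Smallness of `G` from smallness of `G A`, when `T(h)` is a strict contraction. -/
theorem norm_le_of_normCompRightLE {T : ℝ → X →L[ℂ] X} {A : X →ₗ.[ℂ] X} (hT : IsC0Semigroup T)
    (hA : IsGenerator T A) (hc : Continuous fun p : ℝ × X => T p.1 p.2) {C h a : ℝ}
    (hC : ∀ r, ‖T r‖ ≤ C) (hh : 0 ≤ h) (hTh : ‖T h‖ ≤ 1 / 2) (ha : 0 ≤ a) {G : X →L[ℂ] X}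
    (hG : NormCompRightLE A G a) : ‖G‖ ≤ 2 * (a * (C * h)) := by
  have hC0 : 0 ≤ C := (norm_nonneg _).trans (hC 0)
  have key : ‖G‖ ≤ a * (C * h) + ‖G‖ * (1 / 2) := by
    refine ContinuousLinearMap.opNorm_le_bound _ (by positivity) fun x => ?_
    obtain ⟨hx, e⟩ := hA.integral_mem hT hc x hh
    have h1 := hG ⟨_, hx⟩
    rw [e] at h1
    have h2 : ‖∫ r in (0 : ℝ)..h, T r x‖ ≤ C * ‖x‖ * |h - 0| :=
      intervalIntegral.norm_integral_le_of_norm_le_const fun r _ =>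
        ContinuousLinearMap.le_of_opNorm_le _ (hC r) x
    rw [sub_zero, abs_of_nonneg hh] at h2
    -- Here `T(h) x - x = A ∫₀ʰ T(r) x dr` brings in the bound on `G A`, and the factor `1/2` of
    -- `T(h)` lets `‖G‖` be absorbed.
    have h3 : G x = G (T h x) - G (T h x - x) := by rw [map_sub]; abel
    have h4 : ‖G (T h x)‖ ≤ ‖G‖ * (1 / 2 * ‖x‖) :=
      (G.le_opNorm _).trans (by gcongr; exact ContinuousLinearMap.le_of_opNorm_le _ hTh x)
    have h5 : a * ‖∫ r in (0 : ℝ)..h, T r x‖ ≤ a * (C * ‖x‖ * h) := by gcongr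
    have h6 : ‖G (T h x) - G (T h x - x)‖ ≤ ‖G (T h x)‖ + ‖G (T h x - x)‖ := norm_sub_le _ _
    rw [h3]
    calc _ ≤ _ := h6
      _ ≤ ‖G‖ * (1 / 2 * ‖x‖) + a * (C * ‖x‖ * h) := add_le_add h4 (h1.trans h5)
      _ = _ := by ring
  linarith

/-- Integration by parts for a mild solution `y` of `y' = A y + f`, in the form of an estimate:
if `G' = Q` and `A G`, `G A`, `G f` are small, then `∫ T(t - u) Q(u) y(u) du` is close to
`G(t) y(t)`. -/
theorem norm_sub_integral_le {T : ℝ → X →L[ℂ] X} {A : X →ₗ.[ℂ] X} (hT : IsC0Semigroup T)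
    (hA : IsGenerator T A) (hc : Continuous fun p : ℝ × X => T p.1 p.2) {C : ℝ}
    (hC : ∀ r, ‖T r‖ ≤ C) {G Q : ℝ → X →L[ℂ] X} {y f : ℝ → X} {s t a b N : ℝ} (hst : s ≤ t)
    (hG : ∀ u, HasDerivAt G (Q u) u) (hGs : G s = 0) (hQ : Continuous Q) (hyc : Continuous y)
    (hf : Continuous f)
    (hy : ∀ u k, s ≤ u → 0 ≤ k → y (u + k) = T k (y u) + ∫ r in u..u + k, T (u + k - r) (f r))
    (ha : 0 ≤ a) (hl : ∀ u ∈ Icc s t, NormCompLeftLE A (G u) a)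
    (hr : ∀ u ∈ Icc s t, NormCompRightLE A (G u) a) (hb : ∀ u ∈ Icc s t, ‖G u (f u)‖ ≤ b)
    (hN : ∀ u ∈ Icc s t, ‖y u‖ ≤ N) :
    ‖G t (y t) - ∫ u in s..t, T (t - u) (Q u (y u))‖ ≤ C * (2 * a * N + b) * (t - s) := by
  have hC0 : 0 ≤ C := (norm_nonneg _).trans (hC 0)
  have hT0 : ∀ x, T 0 x = x := fun x => by rw [hT.zero]; rfl
  have hGc : Continuous G := continuous_iff_continuousAt.2 fun u => (hG u).continuousAt
  have hqc : Continuous fun r => T (t - r) (Q r (y r)) :=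
    hc.comp (by fun_prop : Continuous fun r => (t - r, Q r (y r)))
  let D : ℝ → X := fun u => T (t - u) (G u (y u)) - ∫ r in s..u, T (t - r) (Q r (y r))
  have hDi : ∀ u, HasDerivAt (fun u => ∫ r in s..u, T (t - r) (Q r (y r)))
      (T (t - u) (Q u (y u))) u := fun u =>
    intervalIntegral.integral_hasDerivAt_right (hqc.intervalIntegrable _ _)
      hqc.stronglyMeasurable.stronglyMeasurableAtFilter hqc.continuousAt
  have hDc : Continuous D := by
    have h1 : Continuous fun u => T (t - u) (G u (y u)) :=
      hc.comp (by fun_prop : Continuous fun u => (t - u, G u (y u)))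
    exact h1.sub (continuous_iff_continuousAt.2 fun u => (hDi u).continuousAt)
  have hDs : D s = 0 := by simp [D, hGs]
  have hDt : D t = G t (y t) - ∫ u in s..t, T (t - u) (Q u (y u)) := by simp [D, hT0]
  rw [← hDt]
  -- As `y u` need not lie in `D(A)`, `G A y` is not directly defined. So `D` is not differentiated;
  -- only the right slopes of `‖D‖` are bounded.
  have main := image_le_of_liminf_slope_right_le_deriv_boundary (f := fun u => ‖D u‖)
    (a := s) (b := t) (B := fun u => C * (2 * a * N + b) * (u - s))
    (B' := fun _ => C * (2 * a * N + b)) hDc.norm.continuousOn (by simp [hDs])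
    (by fun_prop) (fun u _ => by
      simpa using (((hasDerivAt_id u).sub_const s).const_mul
        (C * (2 * a * N + b))).hasDerivWithinAt) ?_
  · exact main ⟨hst, le_rfl⟩
  intro u hu ρ hρ
  have hu' : u ∈ Icc s t := ⟨hu.1, hu.2.le⟩
  refine Eventually.frequently ?_
  obtain ⟨hAG, hAGle⟩ := hl u hu' (y u)
  have l1 : Tendsto (fun k : ℝ => (k⁻¹ • (G (u + k) - G u)) (y u)) (𝓝[>] 0)
      (𝓝 (Q u (y u))) :=
    ((ContinuousLinearMap.apply ℂ X (y u)).continuous.tendsto _).comp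
      (hG u).tendsto_slope_zero_right
  have l2a : Tendsto (fun k : ℝ => k⁻¹ • ∫ r in u..u + k, T (u + k - r) (f r)) (𝓝[>] 0)
      (𝓝 (f u)) := by
    have := tendsto_average (g := fun k r => T (u + k - r) (f r))
      (hc.comp (by fun_prop : Continuous fun p : ℝ × ℝ => (u + p.1 - p.2, f p.2))) u
    simpa [hT0] using this
  have l2b : Tendsto (fun k : ℝ => G (u + k)) (𝓝[>] 0) (𝓝 (G u)) := by
    have : Continuous fun k : ℝ => G (u + k) := by fun_prop
    simpa using (this.tendsto 0).mono_left nhdsWithin_le_nhds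
  have l2 : Tendsto (fun k : ℝ => G (u + k) (k⁻¹ • ∫ r in u..u + k, T (u + k - r) (f r)))
      (𝓝[>] 0) (𝓝 (G u (f u))) :=
    ((by fun_prop : Continuous fun p : (X →L[ℂ] X) × X => p.1 p.2).tendsto (G u, f u)).comp
      (l2b.prodMk_nhds l2a)
  have l4 := hA.tendsto ⟨G u (y u), hAG⟩
  have l5 := (hDi u).tendsto_slope_zero_right
  have lv : Tendsto (fun k : ℝ => k⁻¹ • ∫ r in (0 : ℝ)..k, T r (y u)) (𝓝[>] 0) (𝓝 (y u)) := by
    have := tendsto_average (g := fun _ r => T r (y u))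
      (hc.comp (by fun_prop : Continuous fun p : ℝ × ℝ => (p.2, y u))) 0
    simpa [hT0] using this
  have lt : Tendsto (fun k : ℝ => t - (u + k)) (𝓝[>] 0) (𝓝 (t - u)) := by
    have : Continuous fun k : ℝ => t - (u + k) := by fun_prop
    simpa using (this.tendsto 0).mono_left nhdsWithin_le_nhds
  have lm := ((hc.tendsto _).comp (lt.prodMk_nhds ((l1.add l2).sub l4))).sub l5
  have ltot := lm.norm.add ((lv.norm.const_mul a).const_mul C)
  have hlt : ‖T (t - u) (Q u (y u) + G u (f u) - A ⟨G u (y u), hAG⟩) - T (t - u) (Q u (y u))‖ +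
      C * (a * ‖y u‖) < ρ := by
    refine lt_of_le_of_lt ?_ hρ
    rw [← map_sub, add_sub_assoc, add_sub_cancel_left]
    have h1 : ‖T (t - u) (G u (f u) - A ⟨G u (y u), hAG⟩)‖ ≤ C * (b + a * N) := by
      refine (ContinuousLinearMap.le_of_opNorm_le _ (hC _) _).trans ?_
      gcongr
      refine (norm_sub_le _ _).trans (add_le_add (hb u hu') (hAGle.trans ?_))
      gcongr
      exact hN u hu'
    have h2 : C * (a * ‖y u‖) ≤ C * (a * N) := by gcongr; exact hN u hu'
    linarith
  have hev := ltot.eventually_lt_const hlt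
  have hmap : map (fun k => u + k) (𝓝[>] (0 : ℝ)) = 𝓝[>] u := by
    simp
  rw [← hmap, eventually_map]
  filter_upwards [hev, Ioo_mem_nhdsGT (sub_pos.2 hu.2)] with k hk hk'
  refine lt_of_le_of_lt ?_ hk
  have hk0 : 0 ≤ k := hk'.1.le
  have huk : u + k ∈ Icc s t := ⟨by linarith [hu.1], by linarith [hk'.2]⟩
  have hslope : slope (fun u => ‖D u‖) u (u + k) ≤ ‖k⁻¹ • (D (u + k) - D u)‖ := by
    rw [slope_def_field, add_sub_cancel_left, norm_smul, norm_inv, Real.norm_of_nonneg hk0,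
      div_eq_inv_mul]
    gcongr
    exact norm_sub_norm_le _ _
  refine hslope.trans ?_
  obtain ⟨hv, hAv⟩ := hA.integral_mem hT hc (y u) hk0
  -- This quotient replaces `G A y`: `T(k) y - y` is `A` of an integral in `D(A)`, whose average
  -- tends to `y u`.
  have h3 : ‖T (t - (u + k)) (k⁻¹ • G (u + k) (T k (y u) - y u))‖ ≤
      C * (a * ‖k⁻¹ • ∫ r in (0 : ℝ)..k, T r (y u)‖) := by
    refine (ContinuousLinearMap.le_of_opNorm_le _ (hC _) _).trans ?_
    gcongr
    have := hr (u + k) huk ⟨_, hv⟩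
    rw [hAv] at this
    rw [norm_smul, norm_smul, mul_left_comm]
    gcongr
  have hsplit : k⁻¹ • (D (u + k) - D u) =
      (T (t - (u + k)) ((k⁻¹ • (G (u + k) - G u)) (y u) +
        G (u + k) (k⁻¹ • ∫ r in u..u + k, T (u + k - r) (f r)) -
        k⁻¹ • (T k (G u (y u)) - G u (y u))) -
      k⁻¹ • ((∫ r in s..u + k, T (t - r) (Q r (y r))) - ∫ r in s..u, T (t - r) (Q r (y r)))) +
      T (t - (u + k)) (k⁻¹ • G (u + k) (T k (y u) - y u)) := by
    have e1 : T (t - u) (G u (y u)) = T (t - (u + k)) (T k (G u (y u))) := by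
      have := hT.add (t - (u + k)) k (by linarith [huk.2]) hk0
      rw [show t - (u + k) + k = t - u by ring] at this
      rw [this]; rfl
    simp only [D]
    rw [e1, hy u k hu.1 hk0]
    simp only [map_add, map_sub, ContinuousLinearMap.map_smul_of_tower, smul_sub, smul_add,
      _root_.sub_apply, _root_.smul_apply]
    abel
  rw [hsplit]
  exact (norm_add_le _ _).trans (add_le_add le_rfl h3)

/-- Contraction of solutions over a time step `h` on which the perturbation averages out. -/
theorem norm_solution_le {T : ℝ → X →L[ℂ] X} {A : X →ₗ.[ℂ] X} (hT : IsC0Semigroup T)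
    (hA : IsGenerator T A) (hc : Continuous fun p : ℝ × X => T p.1 p.2) {C h a : ℝ}
    (hC : ∀ r, ‖T r‖ ≤ C) (hC1 : 1 ≤ C) (hh : 0 < h) (hTh : ‖T h‖ ≤ 1 / 4) (ha : 0 ≤ a)
    (hsmall : 6 * (C * h * a) * (8 * C) ≤ 1) {P₁ P₂ : X →L[ℂ] X} {B : ℝ → X →L[ℂ] X}
    (hP : P₂ = ContinuousLinearMap.id ℂ X - P₁) (hB : Continuous B)
    (hB2 : ∀ t, ‖P₂.comp (B t)‖ ≤ a)
    (hCB : ∀ t u, t ≤ u → u ≤ t + h → ‖(P₁.comp (primitive B t u)).comp (B u)‖ ≤ a)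
    (hl : ∀ t u, t ≤ u → u ≤ t + h → NormCompLeftLE A (P₁.comp (primitive B t u)) a)
    (hr : ∀ t u, t ≤ u → u ≤ t + h → NormCompRightLE A (P₁.comp (primitive B t u)) a)
    {s : ℝ} {y : ℝ → X} (hyc : Continuous y) (hy : IsSolution T B s y) :
    (∀ t ∈ Icc s (s + h), ‖y t‖ ≤ 2 * C * ‖y s‖) ∧ ‖y (s + h)‖ ≤ ‖y s‖ / 2 := by
  have hC0 : 0 ≤ C := zero_le_one.trans hC1
  -- All errors are measured by the maximum `N` of `‖y‖` over the step, which is afterwards bounded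
  -- through the estimate at `m` itself.
  obtain ⟨m, hm, hmax⟩ := isCompact_Icc.exists_isMaxOn (nonempty_Icc.2 (by linarith : s ≤ s + h))
    hyc.norm.continuousOn
  set N := ‖y m‖ with hNdef
  have hN0 : 0 ≤ N := norm_nonneg _
  have hN : ∀ u ∈ Icc s (s + h), ‖y u‖ ≤ N := fun u hu => hmax hu
  let G : ℝ → X →L[ℂ] X := fun u => P₁.comp (primitive B s u)
  have hG : ∀ u, HasDerivAt G (P₁.comp (B u)) u := fun u => by
    have h1 : HasDerivAt (primitive B s) (B u) u :=
      intervalIntegral.integral_hasDerivAt_right (hB.intervalIntegrable _ _)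
        hB.stronglyMeasurable.stronglyMeasurableAtFilter hB.continuousAt
    exact ((ContinuousLinearMap.compL ℂ X X X P₁).restrictScalars ℝ).hasFDerivAt.comp_hasDerivAt
      u h1
  have hGs : G s = 0 := by simp [G, primitive]
  have hi : ∀ (S : X →L[ℂ] X) t, IntervalIntegrable (fun u => T (t - u) (S (B u (y u))))
      MeasureTheory.volume s t := fun S t =>
    (hc.comp (by fun_prop : Continuous fun u : ℝ => (t - u, S (B u (y u))))).intervalIntegrable _ _
  have est : ∀ t ∈ Icc s (s + h), ‖y t - T (t - s) (y s)‖ ≤ 6 * (C * h * a) * N := by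
    intro t ht
    have hsub : ∀ u ∈ Icc s t, u ∈ Icc s (s + h) := fun u hu => ⟨hu.1, hu.2.trans ht.2⟩
    have hmain := norm_sub_integral_le hT hA hc hC (G := G) (Q := fun u => P₁.comp (B u))
      (y := y) (f := fun u => B u (y u)) (s := s) (t := t) (a := a) (b := a * N) (N := N) ht.1
      hG hGs (by fun_prop) hyc (by fun_prop)
      (fun u k hu hk => by
        simpa using (hy.restart hT hc hB hyc hu).2 (u + k) (by linarith))
      ha (fun u hu => hl s u hu.1 (hsub u hu).2) (fun u hu => hr s u hu.1 (hsub u hu).2)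
      (fun u hu => (ContinuousLinearMap.le_of_opNorm_le _ (hCB s u hu.1 (hsub u hu).2) (y u)).trans
        (by gcongr; exact hN u (hsub u hu)))
      (fun u hu => hN u (hsub u hu))
    have hGt : ‖G t (y t)‖ ≤ 2 * (a * (C * h)) * N :=
      (ContinuousLinearMap.le_of_opNorm_le _ (norm_le_of_normCompRightLE hT hA hc hC hh.le
        (hTh.trans (by norm_num)) ha (hr s t ht.1 ht.2)) (y t)).trans
        (by gcongr; exact hN t ht)
    have h2 : ‖∫ u in s..t, T (t - u) (P₂ (B u (y u)))‖ ≤ C * (a * N) * |t - s| := by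
      refine intervalIntegral.norm_integral_le_of_norm_le_const fun u hu => ?_
      rw [uIoc_of_le ht.1] at hu
      refine (ContinuousLinearMap.le_of_opNorm_le _ (hC _) _).trans ?_
      gcongr
      exact (ContinuousLinearMap.le_of_opNorm_le _ (hB2 u) (y u)).trans
        (by gcongr; exact hN u (hsub u ⟨hu.1.le, hu.2⟩))
    rw [abs_of_nonneg (sub_nonneg.2 ht.1)] at h2
    have e : y t - T (t - s) (y s) = G t (y t) -
        (G t (y t) - ∫ u in s..t, T (t - u) (P₁ (B u (y u)))) +
        ∫ u in s..t, T (t - u) (P₂ (B u (y u))) := by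
      rw [sub_sub_cancel, ← intervalIntegral.integral_add (hi P₁ t) (hi P₂ t), hy.2 t ht.1,
        add_sub_cancel_left]
      refine intervalIntegral.integral_congr fun u _ => ?_
      rw [← map_add]
      simp [hP]
    rw [e]
    refine ((norm_add_le _ _).trans (add_le_add_left (norm_sub_le _ _) _)).trans ?_
    have hts : t - s ≤ h := by linarith [ht.2]
    have h3 : C * (2 * a * N + a * N) * (t - s) ≤ C * (2 * a * N + a * N) * h := by gcongr
    have h4 : C * (a * N) * (t - s) ≤ C * (a * N) * h := by gcongr
    -- The constant `6 = 2 + 3 + 1` collects the boundary term, the integration by parts and the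
    -- `P₂` part.
    calc _ ≤ 2 * (a * (C * h)) * N + C * (2 * a * N + a * N) * h + C * (a * N) * h :=
          add_le_add (add_le_add hGt (hmain.trans h3)) (h2.trans h4)
      _ = _ := by ring
  set κ := 6 * (C * h * a)
  have hκ0 : 0 ≤ κ := by positivity
  have hκ : κ ≤ 1 / 2 := by nlinarith
  have hNle : N ≤ 2 * C * ‖y s‖ := by
    have h1 := est m hm
    have h2 : ‖T (m - s) (y s)‖ ≤ C * ‖y s‖ := ContinuousLinearMap.le_of_opNorm_le _ (hC _) _
    have h3 : N ≤ ‖y m - T (m - s) (y s)‖ + ‖T (m - s) (y s)‖ := by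
      simpa using norm_add_le (y m - T (m - s) (y s)) (T (m - s) (y s))
    nlinarith
  refine ⟨fun t ht => (hN t ht).trans hNle, ?_⟩
  have h1 := est (s + h) ⟨by linarith, le_rfl⟩
  rw [add_sub_cancel_left] at h1
  have h2 : ‖T h (y s)‖ ≤ 1 / 4 * ‖y s‖ := ContinuousLinearMap.le_of_opNorm_le _ hTh _
  have h3 : ‖y (s + h)‖ ≤ ‖y (s + h) - T h (y s)‖ + ‖T h (y s)‖ := by
    simpa using norm_add_le (y (s + h) - T h (y s)) (T h (y s))
  have h4 : κ * N ≤ κ * (2 * C * ‖y s‖) := by gcongr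
  -- Thus `κ N ≤ 2 C κ ‖y s‖ ≤ ‖y s‖ / 4`, and the free evolution contributes the other quarter.
  have h5 : κ * (8 * C) * ‖y s‖ ≤ 1 * ‖y s‖ := by gcongr
  linarith

end Averaging

/-! ### Existence of mild solutions. -/

section Existence

variable {X : Type*} [NormedAddCommGroup X] [NormedSpace ℂ X] [CompleteSpace X]

theorem integral_exp_neg_mul_sub_le {l : ℝ} (hl : 0 < l) (s t : ℝ) :
    ∫ u in s..t, Real.exp (-(l * (t - u))) ≤ l⁻¹ := by
  have hd : ∀ u ∈ uIcc s t, HasDerivAt (fun u => l⁻¹ * Real.exp (-(l * (t - u))))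
      (Real.exp (-(l * (t - u)))) u := fun u _ => by
    have h1 : HasDerivAt (fun u => -(l * (t - u))) l u := by
      convert! (((hasDerivAt_id u).const_sub t).const_mul l).neg using 1
      simp
    convert! h1.exp.const_mul l⁻¹ using 1
    field_simp
  rw [intervalIntegral.integral_eq_sub_of_hasDerivAt hd
    (Continuous.intervalIntegrable (by fun_prop) _ _)]
  have := mul_nonneg (inv_nonneg.2 hl.le) (Real.exp_nonneg (-(l * (t - s))))
  simpa using this

/-- Mild solutions exist for every initial value: the Banach fixed point theorem in an
exponentially weighted supremum norm. -/
theorem exists_isSolution {T B : ℝ → X →L[ℂ] X} (hT : IsC0Semigroup T)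
    (hc : Continuous fun p : ℝ × X => T p.1 p.2) {C M : ℝ} (hC : ∀ r, ‖T r‖ ≤ C)
    (hB : Continuous B) (hM : ∀ t, ‖B t‖ ≤ M) (s : ℝ) (x : X) :
    ∃ y : ℝ → X, IsSolution T B s y ∧ y s = x := by
  have hC0 : 0 ≤ C := (norm_nonneg _).trans (hC 0)
  have hM0 : 0 ≤ M := (norm_nonneg _).trans (hM 0)
  -- The weight gives the Volterra operator norm at most `C M / l ≤ 1/2`; the `+ 1` keeps `l`
  -- positive when `C M = 0`.
  set l : ℝ := 2 * (C * M) + 1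
  have hl : 0 < l := by positivity
  -- The unknown is `z(t) = exp(-l (t - s)) y(t)`, extended constantly before `s` to be a bounded
  -- continuous function on `ℝ`.
  let V : (ℝ → X) → ℝ → X := fun z t =>
    ∫ u in s..max t s, Real.exp (-(l * (max t s - u))) • T (max t s - u) (B u (z u))
  have hintc : ∀ z : ℝ → X, Continuous z → Continuous fun p : ℝ × ℝ =>
      Real.exp (-(l * (p.1 - p.2))) • T (p.1 - p.2) (B p.2 (z p.2)) := fun z hz =>
    (by fun_prop : Continuous fun p : ℝ × ℝ => Real.exp (-(l * (p.1 - p.2)))).smul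
      (hc.comp (by fun_prop : Continuous fun p : ℝ × ℝ => (p.1 - p.2, B p.2 (z p.2))))
  have hVc : ∀ z : ℝ → X, Continuous z → Continuous (V z) := fun z hz =>
    intervalIntegral.continuous_parametric_intervalIntegral_of_continuous
      (f := fun t u => Real.exp (-(l * (max t s - u))) • T (max t s - u) (B u (z u)))
      ((hintc z hz).comp (by fun_prop : Continuous fun p : ℝ × ℝ => (max p.1 s, p.2)))
      (by fun_prop)
  have hVb : ∀ (z : ℝ → X) N, 0 ≤ N → (∀ u, ‖z u‖ ≤ N) → ∀ t, ‖V z t‖ ≤ 1 / 2 * N := by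
    intro z N hN0 hN t
    have h1 : ‖V z t‖ ≤ ∫ u in s..max t s, (C * (M * N)) * Real.exp (-(l * (max t s - u))) := by
      refine intervalIntegral.norm_integral_le_of_norm_le (le_max_right _ _)
        (.of_forall fun u _ => ?_) (Continuous.intervalIntegrable (by fun_prop) _ _)
      rw [norm_smul, Real.norm_of_nonneg (Real.exp_nonneg _), mul_comm]
      gcongr
      refine (ContinuousLinearMap.le_of_opNorm_le _ (hC _) _).trans ?_
      gcongr
      exact (ContinuousLinearMap.le_of_opNorm_le _ (hM u) _).trans (by gcongr; exact hN u)
    rw [intervalIntegral.integral_const_mul] at h1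
    have h2 : C * (M * N) * (∫ u in s..max t s, Real.exp (-(l * (max t s - u)))) ≤
        C * (M * N) * l⁻¹ := by
      gcongr
      exact integral_exp_neg_mul_sub_le hl s _
    refine h1.trans (h2.trans ?_)
    rw [← div_eq_mul_inv, div_le_iff₀ hl]
    simp only [l]
    nlinarith [mul_nonneg hC0 hM0]
  let W : ℝ → X := fun t => Real.exp (-(l * (max t s - s))) • T (max t s - s) x
  have hWc : Continuous W :=
    (by fun_prop : Continuous fun t : ℝ => Real.exp (-(l * (max t s - s)))).smul
    (hc.comp (by fun_prop : Continuous fun t : ℝ => (max t s - s, x)))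
  have hWb : ∀ t, ‖W t‖ ≤ C * ‖x‖ := fun t => by
    have h1 : Real.exp (-(l * (max t s - s))) ≤ 1 := by
      rw [Real.exp_le_one_iff, neg_nonpos]
      exact mul_nonneg hl.le (sub_nonneg.2 (le_max_right _ _))
    rw [norm_smul, Real.norm_of_nonneg (Real.exp_nonneg _)]
    exact (mul_le_of_le_one_left (norm_nonneg _) h1).trans
      (ContinuousLinearMap.le_of_opNorm_le _ (hC _) _)
  let Φ : BoundedContinuousFunction ℝ X → BoundedContinuousFunction ℝ X := fun z =>
    BoundedContinuousFunction.ofNormedAddCommGroup (fun t => W t + V z t)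
      (hWc.add (hVc z z.continuous)) (C * ‖x‖ + 1 / 2 * ‖z‖) fun t =>
        (norm_add_le _ _).trans (add_le_add (hWb t) (hVb z _ (norm_nonneg z) z.norm_coe_le_norm t))
  have hΦ : ContractingWith (1 / 2) Φ := by
    refine ⟨by norm_num, LipschitzWith.of_dist_le_mul fun z w => ?_⟩
    rw [BoundedContinuousFunction.dist_le (by positivity)]
    intro t
    have e : Φ z t - Φ w t = V (fun u => z u - w u) t := by
      change W t + V z t - (W t + V w t) = _
      rw [add_sub_add_left_eq_sub]
      simp only [V]
      have hi : ∀ z : BoundedContinuousFunction ℝ X, IntervalIntegrable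
          (fun u => Real.exp (-(l * (max t s - u))) • T (max t s - u) (B u (z u)))
          MeasureTheory.volume s (max t s) := fun z =>
        ((hintc z z.continuous).comp
          (by fun_prop : Continuous fun u : ℝ => (max t s, u))).intervalIntegrable _ _
      rw [← intervalIntegral.integral_sub (hi z) (hi w)]
      simp only [map_sub, smul_sub]
    rw [dist_eq_norm, e]
    refine (hVb _ (dist z w) dist_nonneg (fun u => ?_) t).trans (by simp)
    rw [← dist_eq_norm]
    exact BoundedContinuousFunction.dist_coe_le_dist u
  obtain ⟨z, hz, -⟩ := hΦ.exists_fixedPoint 0 (edist_ne_top _ _)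
  have hzt : ∀ t, s ≤ t → z t = Real.exp (-(l * (t - s))) • T (t - s) x +
      ∫ u in s..t, Real.exp (-(l * (t - u))) • T (t - u) (B u (z u)) := by
    intro t ht
    have h1 : z t = W t + V z t := by
      conv_lhs => rw [← hz.eq]
      rfl
    simp only [W, V, max_eq_left ht] at h1
    exact h1
  have hzs : z s = x := by
    rw [hzt s le_rfl]
    simp [hT.zero]
  refine ⟨fun t => Real.exp (l * (t - s)) • z t, ⟨?_, fun t ht => ?_⟩, by simp [hzs]⟩
  · exact ((by fun_prop : Continuous fun t : ℝ => Real.exp (l * (t - s))).smul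
      z.continuous).continuousOn
  · simp only [sub_self, mul_zero, Real.exp_zero, one_smul, hzs]
    rw [hzt t ht, smul_add, smul_smul, ← Real.exp_add, add_neg_cancel, Real.exp_zero, one_smul,
      ← intervalIntegral.integral_smul]
    congr 1
    refine intervalIntegral.integral_congr fun u _ => ?_
    simp only [ContinuousLinearMap.map_smul_of_tower, smul_smul, ← Real.exp_add]
    congr 2
    ring

end Existence

/-! ### Asymptotic stability versus operator norms and uniform contraction. -/

section Stability

variable {X : Type*} [NormedAddCommGroup X] [NormedSpace ℂ X]

theorem opNorm_le_of_norm_lt {L : X →L[ℂ] X} {η ε : ℝ} (hη : 0 < η) (hε : 0 ≤ ε)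
    (h : ∀ x, ‖x‖ < η → ‖L x‖ ≤ ε) : ‖L‖ ≤ 2 * ε / η := by
  refine ContinuousLinearMap.opNorm_le_bound _ (by positivity) fun x => ?_
  rcases eq_or_ne x 0 with rfl | hx
  · simp
  have hx' : 0 < ‖x‖ := norm_pos_iff.2 hx
  set c : ℝ := η / (2 * ‖x‖)
  have hcpos : 0 < c := by positivity
  have h1 := h (c • x) (by
    rw [norm_smul, Real.norm_of_nonneg hcpos.le]
    simp only [c]
    field_simp
    linarith)
  rw [ContinuousLinearMap.map_smul_of_tower, norm_smul, Real.norm_of_nonneg hcpos.le] at h1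
  simp only [c] at h1
  field_simp at h1 ⊢
  linarith

theorem IsC0Semigroup.isSolution_zero {T : ℝ → X →L[ℂ] X} (hT : IsC0Semigroup T) (x : X) :
    IsSolution T (fun _ => 0) 0 fun t => T t x where
  continuousOn := hT.continuousOn x
  formula t _ := by simp [hT.zero]

theorem IsAsympStable.exists_norm_le {T : ℝ → X →L[ℂ] X} (hT : IsC0Semigroup T)
    (h : IsAsympStable T fun _ => 0) : ∃ C, 1 ≤ C ∧ ∀ t, 0 ≤ t → ‖T t‖ ≤ C := by
  obtain ⟨η, hη, H⟩ := h.stable 1 one_pos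
  refine ⟨max 1 (2 * 1 / η), le_max_left _ _, fun t ht => ?_⟩
  refine (opNorm_le_of_norm_lt hη zero_le_one fun x hx => ?_).trans (le_max_right _ _)
  exact (H 0 _ (hT.isSolution_zero x) (by simpa [hT.zero] using hx) t ht).le

theorem IsAsympStable.exists_norm_le_quarter {T : ℝ → X →L[ℂ] X} (hT : IsC0Semigroup T)
    (h : IsAsympStable T fun _ => 0) : ∃ τ > 0, ‖T τ‖ ≤ 1 / 4 := by
  obtain ⟨η, hη, H⟩ := h.attractive
  -- The choice `η / 8` gives `2 (η / 8) / η = 1/4`; the factor `2` comes from rescaling vectors to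
  -- norm `η / 2`.
  obtain ⟨τ, hτ, H⟩ := H (η / 8) (by positivity)
  refine ⟨τ, hτ, (opNorm_le_of_norm_lt hη (by positivity : 0 ≤ η / 8) fun x hx => ?_).trans_eq
    (by field_simp; norm_num)⟩
  exact (H 0 _ (hT.isSolution_zero x) (by simpa [hT.zero] using hx) τ (by simp)).le

/-- Uniform contraction over time steps of fixed length implies asymptotic stability. -/
theorem isAsympStable_of_contraction {T B : ℝ → X →L[ℂ] X} {C h : ℝ} (hC : 0 < C) (hh : 0 < h)
    (H : ∀ s y, IsSolution T B s y → ∀ n : ℕ,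
      (∀ t ∈ Icc (s + n * h) (s + n * h + h), ‖y t‖ ≤ C * (‖y s‖ * (1 / 2) ^ n))) :
    IsAsympStable T B := by
  have key : ∀ s y, IsSolution T B s y → ∀ (m : ℕ) t, s + m * h ≤ t →
      ‖y t‖ ≤ C * (‖y s‖ * (1 / 2) ^ m) := by
    intro s y hy m t ht
    have hnn : 0 ≤ (t - s) / h := div_nonneg (by nlinarith [Nat.cast_nonneg (α := ℝ) m]) hh.le
    have h1 := Nat.floor_le hnn
    have h2 := Nat.lt_floor_add_one ((t - s) / h)
    set n := ⌊(t - s) / h⌋₊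
    rw [le_div_iff₀ hh] at h1
    rw [div_lt_iff₀ hh] at h2
    have hmn : m ≤ n := by
      refine Nat.le_floor ?_
      rw [le_div_iff₀ hh]
      linarith
    refine (H s y hy n t ⟨by linarith, by linarith⟩).trans ?_
    gcongr C * (‖y s‖ * ?_)
    exact pow_le_pow_of_le_one (by norm_num) (by norm_num) hmn
  refine ⟨fun ε hε => ⟨ε / C, by positivity, fun s y hy hs t ht => ?_⟩,
    ⟨1, one_pos, fun ε hε => ?_⟩⟩
  · have := key s y hy 0 t (by simpa using ht)
    rw [lt_div_iff₀ hC] at hs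
    simp only [pow_zero, mul_one] at this
    linarith
  · obtain ⟨m, hm⟩ := exists_pow_lt_of_lt_one (by positivity : 0 < ε / C)
      (by norm_num : (1 / 2 : ℝ) < 1)
    -- `m + 1` instead of `m` keeps the waiting time positive when `m = 0`.
    refine ⟨(m + 1) * h, by positivity, fun s y hy hs t ht => ?_⟩
    have h1 := key s y hy m t (by linarith)
    rw [lt_div_iff₀ hC] at hm
    have h2 : ‖y s‖ * (1 / 2 : ℝ) ^ m ≤ 1 * (1 / 2) ^ m := by gcongr
    nlinarith

end Stability

/-! ### Iterating the one-step contraction, and the main theorem. -/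

section Robustness

variable {X : Type*} [NormedAddCommGroup X] [NormedSpace ℂ X] [CompleteSpace X]

/-- Asymptotic stability under a perturbation whose averages over a time step `h` are small. -/
theorem isAsympStable_of_small_averages {T : ℝ → X →L[ℂ] X} {A : X →ₗ.[ℂ] X}
    (hT : IsC0Semigroup T) (hA : IsGenerator T A) {C h a : ℝ} (hC : ∀ r, 0 ≤ r → ‖T r‖ ≤ C)
    (hC1 : 1 ≤ C) (hh : 0 < h) (hTh : ‖T h‖ ≤ 1 / 4) (ha : 0 ≤ a)
    (hsmall : 6 * (C * h * a) * (8 * C) ≤ 1) {P₁ P₂ : X →L[ℂ] X} {B : ℝ → X →L[ℂ] X}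
    (hP : P₂ = ContinuousLinearMap.id ℂ X - P₁) (hB : Continuous B)
    (hB2 : ∀ t, ‖P₂.comp (B t)‖ ≤ a)
    (hCB : ∀ t u, t ≤ u → u ≤ t + h → ‖(P₁.comp (primitive B t u)).comp (B u)‖ ≤ a)
    (hl : ∀ t u, t ≤ u → u ≤ t + h → NormCompLeftLE A (P₁.comp (primitive B t u)) a)
    (hr : ∀ t u, t ≤ u → u ≤ t + h → NormCompRightLE A (P₁.comp (primitive B t u)) a) :
    IsAsympStable T B := by
  refine isAsympStable_of_contraction (C := 2 * C) (by linarith) hh fun s y hy => ?_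
  have hc := hT.continuous_comp_max hC
  have hT' := hT.comp_max
  have hyc := hy.continuous_comp_max
  have hy' := isSolution_comp_max_iff.2 hy.comp_max
  have hle : ∀ n : ℕ, s ≤ s + n * h := fun n => by
    have : 0 ≤ n * h := by positivity
    linarith
  have step : ∀ n : ℕ, _ := fun n =>
    norm_solution_le hT' hA.comp_max hc (fun r => hC _ (le_max_right r 0)) hC1 hh
      (by rwa [max_eq_left hh.le]) ha hsmall hP hB hB2 hCB hl hr hyc
      (hy'.restart hT' hc hB hyc (hle n))
  have decay : ∀ n : ℕ, ‖y (max (s + n * h) s)‖ ≤ ‖y s‖ * (1 / 2) ^ n := by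
    intro n
    induction n with
    | zero => simp
    | succ n ih =>
      have h1 := (step n).2
      rw [show s + ((n + 1 : ℕ) : ℝ) * h = s + n * h + h by push_cast; ring, pow_succ]
      linarith
  intro n t ht
  have h1 := (step n).1 t ht
  rw [max_eq_left ((hle n).trans ht.1)] at h1
  refine h1.trans ?_
  gcongr
  exact decay n

end Robustness

end Semigroups

theorem mainTheorem4 {X : Type*} [NormedAddCommGroup X] [NormedSpace ℂ X] [CompleteSpace X]
    (T : ℝ → X →L[ℂ] X) (A : X →ₗ.[ℂ] X)
    (hT : Semigroups.IsC0Semigroup T) (hA : Semigroups.IsGenerator T A) :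
    -- `A P₁` is a bounded operator, `P₁ A = A P₁` on `D(A)`, so `P₁ A` is bounded as well
    (∀ (σ₁ : Set ℂ) (γ : ℝ → ℂ), Semigroups.IsSeparated A σ₁ γ →
      ∃ L : X →L[ℂ] X,
        (∀ x : X, ∃ hx : Semigroups.rieszProj A γ x ∈ A.domain,
          A ⟨Semigroups.rieszProj A γ x, hx⟩ = L x) ∧
        ∀ x : A.domain, Semigroups.rieszProj A γ (A x) = L x) ∧
    -- robustness of stability; `δ₀` and `h₀` depend neither on the decomposition nor on `B`
    (Semigroups.IsAsympStable T (fun _ => 0) →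
      ∀ K α μ M : ℝ, α < μ →
      ∃ δ₀ > 0, ∃ h₀ > 0, ∀ δ h : ℝ, 0 < δ → δ ≤ δ₀ → h₀ ≤ h →
      ∀ (σ₁ : Set ℂ) (γ : ℝ → ℂ) (P₁ P₂ : X →L[ℂ] X) (B : ℝ → X →L[ℂ] X),
        Semigroups.IsSeparated A σ₁ γ →
        P₁ = Semigroups.rieszProj A γ →
        P₂ = ContinuousLinearMap.id ℂ X - P₁ →
        (∀ t, 0 ≤ t → ‖(T t).comp P₁‖ ≤ K * Real.exp (-α * t)) →
        (∀ t, 0 ≤ t → ‖(T t).comp P₂‖ ≤ K * Real.exp (-μ * t)) →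
        Continuous B →
        (∀ t, ‖B t‖ ≤ M) →
        (∀ t, ‖P₂.comp (B t)‖ ≤ M * δ) →
        (∀ t u, t ≤ u → u ≤ t + h →
          ‖(P₁.comp (Semigroups.primitive B t u)).comp (B u)‖ ≤ M * δ) →
        (∀ t u, t ≤ u → u ≤ t + h →
          Semigroups.NormCompLeftLE A (P₁.comp (Semigroups.primitive B t u)) (M * δ)) →
        (∀ t u, t ≤ u → u ≤ t + h →
          Semigroups.NormCompRightLE A (P₁.comp (Semigroups.primitive B t u)) (M * δ)) →
        (∀ (s : ℝ) (x : X), ∃ y : ℝ → X, Semigroups.IsSolution T B s y ∧ y s = x) ∧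
          Semigroups.IsAsympStable T B) := by
  refine ⟨fun σ₁ γ h => h.exists_comp_rieszProj, fun hS K α μ M _ => ?_⟩
  obtain ⟨C, hC1, hC⟩ := hS.exists_norm_le hT
  obtain ⟨h₀, hh₀, hTh⟩ := hS.exists_norm_le_quarter hT
  have hC0 : 0 < C := zero_lt_one.trans_le hC1
  -- With `a = M δ` the smallness condition reads `48 C² h₀ M δ ≤ 1`; `|M| + 1` is positive whatever
  -- the sign of `M`, which is known only once `B` is given.
  refine ⟨1 / (48 * C ^ 2 * h₀ * (|M| + 1)), by positivity, h₀, hh₀, ?_⟩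
  intro δ h hδ hδ₀ hh σ₁ γ P₁ P₂ B _ _ hP₂ _ _ hB hM hB2 hCB hl hr
  have hM0 : 0 ≤ M := (norm_nonneg _).trans (hM 0)
  -- The time step is `h₀`, not `h`, so that `δ₀` can be independent of `h`.
  have hle : ∀ {t u : ℝ}, u ≤ t + h₀ → u ≤ t + h := fun hu => hu.trans (by linarith)
  refine ⟨fun s x => ?_, ?_⟩
  · obtain ⟨y, hy, hys⟩ := Semigroups.exists_isSolution hT.comp_max (hT.continuous_comp_max hC)
      (fun r => hC _ (le_max_right r 0)) hB hM s x
    exact ⟨y, Semigroups.isSolution_comp_max_iff.1 hy, hys⟩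
  · refine Semigroups.isAsympStable_of_small_averages hT hA hC hC1 hh₀ hTh (by positivity) ?_ hP₂
      hB hB2 (fun t u htu hu => hCB t u htu (hle hu)) (fun t u htu hu => hl t u htu (hle hu))
      (fun t u htu hu => hr t u htu (hle hu))
    rw [le_div_iff₀ (by positivity), abs_of_nonneg hM0] at hδ₀
    have : 0 ≤ 48 * C ^ 2 * h₀ * δ := by positivity
    linarith
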